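/- Let $n\ge 1$, let $\Gamma\subset SL(2,\mathbb R)$ be a discrete subgroup acting freely on the hyperbolic plane $\mathbb H^2$ (with the metric of curvature $-1$ and its complex structure) with compact quotient $S=\mathbb H^2/\Gamma$. Let $L_k=(T\mathbb H^2)^{\otimes_{\mathbb C}k}$, with the induced metric $\langle\,,\rangle$ (the real part of the induced Hermitian metric) and the connection $\overline\nabla$ induced by the Levi-Civita connection. For $X\in T\mathbb H^2$ and $Y\in L_k$, let $i_XY\in L_{k-1}$ be defined by $\langle i_XY,Z\rangle=\langle Y,X\otimes Z\rangle$ for all $Z\in L_{k-1}$. On $E=\mathbb R\oplus L_1\oplus\dots\oplus L_n$ consider the connection $\nabla$ given, for a section $Y=(Y_0,\dots,Y_n)$, by $$(\nabla_XY)_0=L_XY_0+\tfrac12(n+1)\langle X,Y_1\rangle,$$ $$(\nabla_XY)_k=(n-k+1)\,X\otimes Y_{k-1}+\overline\nabla_XY_k+\tfrac14(n+k+1)\,i_XY_{k+1}\qquad(1\le k\le n,\ Y_{n+1}=0).$$ $SL(2,\mathbb R)$ acts on $E$ by bundle automorphisms, through the differentials of its action on $\mathbb H^2$. Let $E_S=E/\Gamma$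 be the quotient bundle over $S$; its smooth sections and the smooth $E_S$-valued forms on $S$ are the $\Gamma$-invariant smooth sections of $E$ and the $\Gamma$-invariant smooth $E$-valued forms on $\mathbb H^2$. Let $d^\nabla$ be the exterior derivative on these forms: $(d^\nabla u)(X)=\nabla_Xu$ for a section $u$, and $(d^\nabla\alpha)(X,Y)=\nabla_X(\alpha(Y))-\nabla_Y(\alpha(X))-\alpha([X,Y])$ for a $1$-form $\alpha$. For a holomorphic $(n+1)$-differential $\omega$ on $S$, that is, a $\Gamma$-invariant holomorphic section of the complex dual $L_{n+1}^*$, let $\check\omega$ be the section of $L_{n+1}$ with $\langle\check\omega,Z\rangle=\operatorname{Re}\omega(Z)$ for all $Z\in L_{n+1}$, and let $\Phi(\omega)$ be the $E$-valued $1$-form $X\mapsto i_X\check\omega\in L_n\subset E$. Then, for every holomorphic $(n+1)$-differential $\omega$ on $S$, $\Phi(\omega)$ is a smooth $E_S$-valued $1$-form on $S$ and $d^\nabla(\Phi(\omega))=0$. Furthermore, if $\Phi(\omega)=d^\nabla u$ for some smooth section $u$ of $E_S$ over $S$, then $\omega=0$. -/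

import Mathlib

open scoped UpperHalfPlane MatrixGroups ContDiff ComplexConjugate

noncomputable section

namespace Fuchsian

open UpperHalfPlane

/-! The upper half-plane `ℍ` has the global holomorphic coordinate `z`.  The vector field `∂/∂x`
identifies `T_z ℍ` with `ℂ` (the complex structure being multiplication by `i`), and the section
`(∂/∂x)^{⊗ k}` identifies the fibre of the complex line bundle `L_k = (Tℍ)^{⊗_ℂ k}` with `ℂ`.  Under
these identifications the tensor product `L_j ⊗_ℂ L_k = L_{j+k}` is the product of complex numbers. -/

/-! ### Surface groups and their action on the line bundles -/

/-- `Γ ⊂ SL(2, ℝ)` is the group of a compact surface `S = ℍ / Γ`: it is discrete, it acts freely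
on `ℍ`, and the quotient is compact. -/
structure IsSurfaceGroup (Γ : Subgroup SL(2, ℝ)) : Prop where
  discrete : DiscreteTopology Γ
  free : ∀ γ ∈ Γ, γ ≠ 1 → ∀ z : ℍ, γ • z ≠ z
  cocompact : CompactSpace (MulAction.orbitRel.Quotient Γ ℍ)

/-- The complex number by which the differential at `z` of `w ↦ γ • w` acts from `T_z ℍ = ℂ` to
`T_{γ • z} ℍ = ℂ`. -/
def moebiusDeriv (γ : SL(2, ℝ)) (z : ℍ) : ℂ :=
  deriv (fun w : ℂ => ((γ • ofComplex w : ℍ) : ℂ)) z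

/-- The usual formula `1 / (c z + d) ^ 2` for this differential. -/
theorem moebiusDeriv_eq (γ : SL(2, ℝ)) (z : ℍ) :
    moebiusDeriv γ z = 1 / (((γ 1 0 : ℝ) : ℂ) * z + ((γ 1 1 : ℝ) : ℂ)) ^ 2 := by
  have hne : (((γ 1 0 : ℝ) : ℂ) * z + ((γ 1 1 : ℝ) : ℂ)) ≠ 0 := by
    simpa [denom] using denom_ne_zero (γ : GL (Fin 2) ℝ) z
  have hdet : ((γ 0 0 : ℝ) : ℂ) * ((γ 1 1 : ℝ) : ℂ) - ((γ 0 1 : ℝ) : ℂ) * ((γ 1 0 : ℝ) : ℂ) = 1 := by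
    have h := γ.det_coe
    rw [Matrix.det_fin_two] at h
    exact_mod_cast h
  have hev : (fun w : ℂ => ((γ • ofComplex w : ℍ) : ℂ)) =ᶠ[nhds (z : ℂ)]
      fun w : ℂ => (((γ 0 0 : ℝ) : ℂ) * w + ((γ 0 1 : ℝ) : ℂ)) /
        (((γ 1 0 : ℝ) : ℂ) * w + ((γ 1 1 : ℝ) : ℂ)) := by
    filter_upwards [eventuallyEq_coe_comp_ofComplex z.im_pos] with w hw
    have hw' : ((ofComplex w : ℍ) : ℂ) = w := hw
    simp [coe_specialLinearGroup_apply, hw']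
  have h1 : HasDerivAt (fun w : ℂ => ((γ 0 0 : ℝ) : ℂ) * w + ((γ 0 1 : ℝ) : ℂ))
      ((γ 0 0 : ℝ) : ℂ) (z : ℂ) := by
    simpa using ((hasDerivAt_id (z : ℂ)).const_mul ((γ 0 0 : ℝ) : ℂ)).add_const ((γ 0 1 : ℝ) : ℂ)
  have h2 : HasDerivAt (fun w : ℂ => ((γ 1 0 : ℝ) : ℂ) * w + ((γ 1 1 : ℝ) : ℂ))
      ((γ 1 0 : ℝ) : ℂ) (z : ℂ) := by
    simpa using ((hasDerivAt_id (z : ℂ)).const_mul ((γ 1 0 : ℝ) : ℂ)).add_const ((γ 1 1 : ℝ) : ℂ)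
  refine (hev.deriv_eq.trans (h1.div h2 hne).deriv).trans ?_
  congr 1
  linear_combination hdet

/-! ### Hermitian geometry of the bundles `L_k` -/

/-- The metric `⟨a, b⟩` on the fibre of `L_k` at `z` induced by the hyperbolic metric
`(dx² + dy²) / y²`. -/
def metric (k : ℕ) (z : ℍ) (a b : ℂ) : ℝ := (a * conj b).re / z.im ^ (2 * k)

/-- The contraction `i_X Y ∈ L_{k-1}` of `Y ∈ L_k` by the tangent vector `X` at `z`. -/
def contract (z : ℍ) (X Y : ℂ) : ℂ := conj X * Y / (z.im : ℂ) ^ 2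

/-- `contract` is the adjoint of the tensor product by `X`. -/
theorem metric_contract (k : ℕ) (z : ℍ) (X Y Z : ℂ) :
    metric k z (contract z X Y) Z = metric (k + 1) z Y (X * Z) := by
  have h : contract z X Y * conj Z = (((z.im ^ 2)⁻¹ : ℝ) : ℂ) * (Y * conj (X * Z)) := by
    simp only [contract, map_mul]
    push_cast
    ring
  have hz := z.im_ne_zero
  rw [metric, metric, h, Complex.re_ofReal_mul]
  field_simp
  ring

/-- The derivative at `z`, in the coordinate `z`, of a function on `ℍ`. -/
def derivAt {F : Type*} [NormedAddCommGroup F] [NormedSpace ℝ F] (f : ℍ → F) (z : ℍ) : ℂ →L[ℝ] F :=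
  fderiv ℝ (fun w : ℂ => f (ofComplex w)) z

/-- Smoothness (in the real sense) of a function on `ℍ`. -/
def IsSmooth {F : Type*} [NormedAddCommGroup F] [NormedSpace ℝ F] (f : ℍ → F) : Prop :=
  ContDiffOn ℝ ∞ (fun w : ℂ => f (ofComplex w)) {w | 0 < w.im}

/-- The covariant derivative at `z`, in the direction `X`, of the section `Y` of `L_k`, for the
connection induced by the Levi-Civita connection of the hyperbolic metric (the connection form of
`L_1` in the frame `∂/∂x` is `∂ log y⁻² = (i / y) dz`). -/
def leviCivita (k : ℕ) (X : ℂ) (Y : ℍ → ℂ) (z : ℍ) : ℂ :=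
  derivAt Y z X + k * (Complex.I / z.im) * X * Y z

/-- The connection on `L_1 = Tℍ` is torsion-free. -/
theorem leviCivita_torsion_free (X Y : ℍ → ℂ) (z : ℍ) :
    leviCivita 1 (X z) Y z - leviCivita 1 (Y z) X z = derivAt Y z (X z) - derivAt X z (Y z) := by
  simp only [leviCivita]
  ring

/-- The connection on `L_k` is metric. -/
theorem leviCivita_metric (k : ℕ) (X : ℂ) (Y Z : ℍ → ℂ) (hY : IsSmooth Y) (hZ : IsSmooth Z)
    (z : ℍ) :
    derivAt (fun w => metric k w (Y w) (Z w)) z X =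
      metric k z (leviCivita k X Y z) (Z z) + metric k z (Y z) (leviCivita k X Z z) := by
  have hopen : IsOpen {w : ℂ | 0 < w.im} := isOpen_lt continuous_const Complex.continuous_im
  have hd : ∀ {W : ℍ → ℂ}, IsSmooth W →
      HasFDerivAt (fun w : ℂ => W (ofComplex w)) (derivAt W z) (z : ℂ) := fun hW =>
    ((hW.contDiffAt (hopen.mem_nhds z.im_pos)).differentiableAt (by simp)).hasFDerivAt
  have hY' := hd hY
  have hZ' := hd hZ
  have hz := z.im_ne_zero
  have hev : (fun w : ℂ => metric k (ofComplex w) (Y (ofComplex w)) (Z (ofComplex w)))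
      =ᶠ[nhds (z : ℂ)]
      fun w : ℂ => (Y (ofComplex w) * conj (Z (ofComplex w))).re * (w.im ^ (2 * k))⁻¹ := by
    filter_upwards [eventuallyEq_coe_comp_ofComplex z.im_pos] with w hw
    have hw' : ((ofComplex w : ℍ) : ℂ) = w := hw
    have hw2 : (ofComplex w : ℍ).im = w.im := by rw [← coe_im, hw']
    simp [metric, hw2, div_eq_mul_inv]
  have h1 : HasFDerivAt (fun w : ℂ => (Y (ofComplex w) * conj (Z (ofComplex w))).re) _ (z : ℂ) :=
    Complex.reCLM.hasFDerivAt.comp (z : ℂ)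
      (hY'.mul (Complex.conjCLE.toContinuousLinearMap.hasFDerivAt.comp (z : ℂ) hZ'))
  have h2 : HasFDerivAt (fun w : ℂ => (w.im ^ (2 * k))⁻¹) _ (z : ℂ) :=
    ((hasDerivAt_inv (x := (z : ℂ).im ^ (2 * k)) (pow_ne_zero _ hz)).hasFDerivAt.comp (z : ℂ)
      ((Complex.imCLM.hasFDerivAt (x := (z : ℂ))).pow (2 * k)))
  have h3 := h1.mul h2
  have h4 := (hev.fderiv_eq (𝕜 := ℝ)).trans h3.fderiv
  rw [derivAt, h4]
  rcases Nat.eq_zero_or_pos k with rfl | hk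
  · simp [metric, leviCivita]
    ring
  obtain ⟨m, rfl⟩ : ∃ m, k = m + 1 := ⟨k - 1, by omega⟩
  have e : 2 * (m + 1) - 1 = 2 * m + 1 := by omega
  simp [metric, leviCivita, e]
  field_simp
  ring

/-! ### The flat bundle `E = ℝ ⊕ L_1 ⊕ ⋯ ⊕ L_n` -/

/-- The fibre of `E`; the entry of index `j : Fin n` is the component on `L_{j+1}`. -/
abbrev Fiber (n : ℕ) : Type := ℝ × (Fin n → ℂ)

/-- The component `Y_k` of an element of a fibre of `E`, which is `0` for `k > n`. -/
def comp {n : ℕ} (Y : Fiber n) : ℕ → ℂ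
  | 0 => (Y.1 : ℂ)
  | k + 1 => if h : k < n then Y.2 ⟨k, h⟩ else 0

/-- The action of `γ` from the fibre of `E` at `z` to the fibre of `E` at `γ • z`. -/
def act {n : ℕ} (γ : SL(2, ℝ)) (z : ℍ) (Y : Fiber n) : Fiber n :=
  (Y.1, fun j => moebiusDeriv γ z ^ ((j : ℕ) + 1) * Y.2 j)

/-- The covariant derivative `∇_X Y` at `z`, as a function of the direction `X`:
`(∇_X Y)_0 = L_X Y_0 + (n+1)/2 ⟨X, Y_1⟩` and, for `1 ≤ k ≤ n`,
`(∇_X Y)_k = (n-k+1) X ⊗ Y_{k-1} + ∇̄_X Y_k + (n+k+1)/4 i_X Y_{k+1}`. -/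
def nabla {n : ℕ} (Y : ℍ → Fiber n) (z : ℍ) (X : ℂ) : Fiber n :=
  (derivAt (fun w => (Y w).1) z X + ((n : ℝ) + 1) / 2 * metric 1 z X (comp (Y z) 1),
   fun j =>
    let k : ℕ := (j : ℕ) + 1
    ((n : ℂ) - k + 1) * (X * comp (Y z) (k - 1))
      + leviCivita k X (fun w => comp (Y w) k) z
      + ((n : ℂ) + k + 1) / 4 * contract z X (comp (Y z) (k + 1)))

/-- Smooth sections of `E_S = E / Γ` over `S = ℍ / Γ`, that is, `Γ`-invariant smooth sections of
`E` over `ℍ`. -/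
def IsSection {n : ℕ} (Γ : Subgroup SL(2, ℝ)) (u : ℍ → Fiber n) : Prop :=
  IsSmooth u ∧ ∀ γ ∈ Γ, ∀ z : ℍ, u (γ • z) = act γ z (u z)

/-- Smooth `1`-forms on `S` with values in `E_S`, that is, `Γ`-invariant smooth `1`-forms on `ℍ`
with values in `E`. -/
def IsOneForm {n : ℕ} (Γ : Subgroup SL(2, ℝ)) (α : ℍ → (ℂ →L[ℝ] Fiber n)) : Prop :=
  IsSmooth α ∧ ∀ γ ∈ Γ, ∀ (z : ℍ) (X : ℂ), α (γ • z) (moebiusDeriv γ z * X) = act γ z (α z X)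

/-- The `2`-form `d^∇ α` evaluated on the vector fields `X` and `Y`:
`∇_X (α(Y)) - ∇_Y (α(X)) - α([X, Y])`. -/
def dNabla {n : ℕ} (α : ℍ → (ℂ →L[ℝ] Fiber n)) (X Y : ℍ → ℂ) (z : ℍ) : Fiber n :=
  nabla (fun w => α w (Y w)) z (X z) - nabla (fun w => α w (X w)) z (Y z)
    - α z (VectorField.lieBracket ℝ (fun w : ℂ => X (ofComplex w))
        (fun w : ℂ => Y (ofComplex w)) z)

/-- `d^∇ α = 0`. -/
def IsDNablaClosed {n : ℕ} (α : ℍ → (ℂ →L[ℝ] Fiber n)) : Prop :=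
  ∀ X Y : ℍ → ℂ, IsSmooth X → IsSmooth Y → ∀ z, dNabla α X Y z = 0

/-- `α = d^∇ u` for some smooth section `u` of `E_S`, where `(d^∇ u)(X) = ∇_X u`. -/
def IsDNablaExact {n : ℕ} (Γ : Subgroup SL(2, ℝ)) (α : ℍ → (ℂ →L[ℝ] Fiber n)) : Prop :=
  ∃ u : ℍ → Fiber n, IsSection Γ u ∧ ∀ (z : ℍ) (X : ℂ), α z X = nabla u z X

/-! ### Holomorphic differentials and the map `Φ` -/

/-- Holomorphic `q`-differentials on `S = ℍ / Γ`: `Γ`-invariant holomorphic sections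
`ω = f dz^q` of the complex dual of `L_q`, recorded by the coefficient `f`. -/
def IsHolomorphicDifferential (Γ : Subgroup SL(2, ℝ)) (q : ℕ) (f : ℍ → ℂ) : Prop :=
  DifferentiableOn ℂ (fun w : ℂ => f (ofComplex w)) {w | 0 < w.im} ∧
    ∀ γ ∈ Γ, ∀ z : ℍ, f (γ • z) * moebiusDeriv γ z ^ q = f z

/-- The element `ω̌` of the fibre of `L_q` at `z` dual to the complex linear form `Z ↦ f Z`. -/
def sharp (q : ℕ) (z : ℍ) (f : ℂ) : ℂ := (z.im : ℂ) ^ (2 * q) * conj f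

/-- `⟨ω̌, Z⟩ = Re ω(Z)`. -/
theorem metric_sharp (q : ℕ) (z : ℍ) (f Z : ℂ) : metric q z (sharp q z f) Z = (f * Z).re := by
  have h : sharp q z f * conj Z = ((z.im ^ (2 * q) : ℝ) : ℂ) * conj (f * Z) := by
    simp only [sharp, map_mul]
    push_cast
    ring
  have hz := z.im_ne_zero
  rw [metric, h, Complex.re_ofReal_mul, Complex.conj_re]
  field_simp

/-- The `E`-valued `1`-form `Φ(ω) : X ↦ i_X ω̌ ∈ L_n ⊂ E` attached to an `(n+1)`-differential `ω`
with coefficient `f`. -/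
def Phi (n : ℕ) (f : ℍ → ℂ) (z : ℍ) : ℂ →L[ℝ] Fiber n :=
  LinearMap.toContinuousLinearMap
    { toFun := fun X =>
        (0, fun j => if (j : ℕ) + 1 = n then contract z X (sharp (n + 1) z (f z)) else 0)
      map_add' := by
        intro X Y
        ext j
        · simp
        · by_cases h : (j : ℕ) + 1 = n <;> simp [h, contract]
          ring
      map_smul' := by
        intro c X
        ext j
        · simp
        · by_cases h : (j : ℕ) + 1 = n <;> simp [h, contract]
          ring }

end Fuchsian

end

noncomputable section

namespace Fuchsian

open UpperHalfPlane Filter Topology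

/-! In the coordinate `z`, `Φ(ω)` is `c d\bar z` with values in `L_n`, where `c = y^{2n} \bar f`
(`coeffPhi`). It is invariant because `y²` scales by `|γ'|²`.

Closedness: nothing is produced in degree `n + 1`, since `E` stops at `L_n`. In degree `n - 1` the
expression is symmetric in the two vector fields and cancels. In degree `n` only the `(1,0)`-part of
`∇̄c` matters, and it vanishes because `f` is holomorphic (`derivAt_coeffPhi`).

Non-exactness: suppose `Φ(ω) = d^∇ u`. The degree 0 equation expresses `du_0` through `u_1`. In
degree 1 the complex linear part in `X` loses both `i_X u_2` and `Φ(ω)`, leaving `∇̄^{1,0} u_1 = -n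
u_0 dz`. Together they give `y² Δ u_0 = n(n+1) u_0`, so the maximum principle on the compact
quotient forces `u_0 = 0` (`fst_eq_zero_of_nabla_eq_Phi`). The equations of degree `0, …, n-1` then
kill `u_1, …, u_n` in turn, and the one of degree `n` reads `Φ(ω) = 0`. -/

theorem isOpen_im_pos : IsOpen {w : ℂ | 0 < w.im} :=
  isOpen_lt continuous_const Complex.continuous_im

theorem coe_ofComplex_of_im_pos {w : ℂ} (hw : 0 < w.im) : ((ofComplex w : ℍ) : ℂ) = w :=
  (eventuallyEq_coe_comp_ofComplex hw).self_of_nhds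

theorem im_ofComplex_of_im_pos {w : ℂ} (hw : 0 < w.im) : (ofComplex w).im = w.im := by
  rw [← coe_im, coe_ofComplex_of_im_pos hw]

section Smooth

variable {F G : Type*} [NormedAddCommGroup F] [NormedSpace ℝ F] [NormedAddCommGroup G]
  [NormedSpace ℝ G]

theorem IsSmooth.hasFDerivAt {f : ℍ → F} (hf : IsSmooth f) (z : ℍ) :
    HasFDerivAt (fun w : ℂ => f (ofComplex w)) (derivAt f z) (z : ℂ) :=
  ((hf.contDiffAt (isOpen_im_pos.mem_nhds z.im_pos)).differentiableAt (by simp)).hasFDerivAt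

theorem IsSmooth.continuous {f : ℍ → F} (hf : IsSmooth f) : Continuous f := by
  rw [continuous_iff_continuousAt]
  intro z
  have h : ContinuousAt ((fun w : ℂ => f (ofComplex w)) ∘ ((↑) : ℍ → ℂ)) z :=
    (hf.hasFDerivAt z).continuousAt.comp continuous_coe.continuousAt
  refine h.congr (Eventually.of_forall fun w => ?_)
  simp

theorem IsSmooth.clm_comp {f : ℍ → F} (hf : IsSmooth f) (A : F →L[ℝ] G) :
    IsSmooth fun z => A (f z) :=
  A.contDiff.comp_contDiffOn hf

theorem derivAt_const (c : F) (z : ℍ) : derivAt (fun _ : ℍ => c) z = 0 := by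
  simp [derivAt]

end Smooth

theorem isSmooth_comp {n : ℕ} {u : ℍ → Fiber n} (hu : IsSmooth u) (k : ℕ) :
    IsSmooth fun z => comp (u z) k := by
  rcases k with _ | k
  · exact hu.clm_comp (Complex.ofRealCLM ∘L ContinuousLinearMap.fst ℝ ℝ (Fin n → ℂ))
  · by_cases h : k < n
    · simpa [comp, h] using hu.clm_comp
        (ContinuousLinearMap.proj (R := ℝ) (φ := fun _ : Fin n => ℂ) ⟨k, h⟩ ∘L
          ContinuousLinearMap.snd ℝ ℝ (Fin n → ℂ))
    · simp only [comp, h, dite_false]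
      exact contDiffOn_const

/-! ### The form `Φ(ω)` -/

/-- The coefficient `y^{2n} \bar f` of `d\bar z` in `Φ(f dz^{n+1})`. -/
def coeffPhi (n : ℕ) (f : ℍ → ℂ) (z : ℍ) : ℂ := (z.im : ℂ) ^ (2 * n) * conj (f z)

theorem contract_sharp (n : ℕ) (f : ℍ → ℂ) (z : ℍ) (X : ℂ) :
    contract z X (sharp (n + 1) z (f z)) = conj X * coeffPhi n f z := by
  have hz : (z.im : ℂ) ≠ 0 := by exact_mod_cast z.im_ne_zero
  simp only [contract, sharp, coeffPhi]
  field_simp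
  ring

theorem Phi_apply (n : ℕ) (f : ℍ → ℂ) (z : ℍ) (X : ℂ) :
    Phi n f z X =
      ((0, fun j : Fin n => if (j : ℕ) + 1 = n then conj X * coeffPhi n f z else 0) : Fiber n) := by
  simp only [← contract_sharp]
  rfl

/-- The form `X ↦ \bar X c` with values in the last summand of the fibre, as a function of `c`. -/
def lastForm (n : ℕ) : ℂ →L[ℝ] ℂ →L[ℝ] Fiber n :=
  let e : ℂ →L[ℝ] Fiber n := ContinuousLinearMap.inr ℝ ℝ (Fin n → ℂ) ∘L
    ContinuousLinearMap.pi fun j : Fin n =>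
      if (j : ℕ) + 1 = n then ContinuousLinearMap.id ℝ ℂ else 0
  ((ContinuousLinearMap.compL ℝ ℂ ℂ (Fiber n) e) ∘L
    ((ContinuousLinearMap.compL ℝ ℂ ℂ ℂ).flip Complex.conjCLE.toContinuousLinearMap)) ∘L
      ContinuousLinearMap.mul ℝ ℂ

theorem Phi_fst (n : ℕ) (f : ℍ → ℂ) (z : ℍ) (X : ℂ) : (Phi n f z X).1 = 0 := rfl

theorem Phi_snd (n : ℕ) (f : ℍ → ℂ) (z : ℍ) (X : ℂ) (j : Fin n) :
    (Phi n f z X).2 j = if (j : ℕ) + 1 = n then conj X * coeffPhi n f z else 0 := by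
  rw [Phi_apply]

/-- Factoring through a fixed continuous linear map reduces smoothness of the operator-valued `Phi n
f` to that of its scalar coefficient. -/
theorem Phi_eq_lastForm (n : ℕ) (f : ℍ → ℂ) (z : ℍ) :
    Phi n f z = lastForm n (coeffPhi n f z) := by
  ext X
  · simp [Phi_apply, lastForm]
  · rename_i j
    by_cases h : (j : ℕ) + 1 = n <;> simp [Phi_apply, lastForm, h, mul_comm]

theorem isSmooth_of_holomorphic {f : ℍ → ℂ}
    (hf : DifferentiableOn ℂ (fun w : ℂ => f (ofComplex w)) {w | 0 < w.im}) : IsSmooth f :=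
  (hf.contDiffOn isOpen_im_pos).restrict_scalars ℝ

theorem isSmooth_coeffPhi (n : ℕ) {f : ℍ → ℂ} (hf : IsSmooth f) : IsSmooth (coeffPhi n f) := by
  have h1 : ContDiffOn ℝ ∞ (fun w : ℂ => ((w.im : ℂ)) ^ (2 * n) * conj (f (ofComplex w)))
      {w | 0 < w.im} :=
    (((Complex.ofRealCLM ∘L Complex.imCLM).contDiff.pow (2 * n)).contDiffOn).mul
      (Complex.conjCLE.toContinuousLinearMap.contDiff.comp_contDiffOn hf)
  refine h1.congr fun w hw => ?_
  simp only [coeffPhi, im_ofComplex_of_im_pos hw]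

theorem isSmooth_Phi (n : ℕ) {f : ℍ → ℂ} (hf : IsSmooth f) : IsSmooth (Phi n f) := by
  have h : Phi n f = fun z => lastForm n (coeffPhi n f z) := funext (Phi_eq_lastForm n f)
  rw [h]
  exact (isSmooth_coeffPhi n hf).clm_comp (lastForm n)

/-! ### Invariance and closedness of `Φ(ω)` -/

/-- Möbius maps are isometries of `|dz|² / y²`. -/
theorem im_smul_eq_mul_moebiusDeriv (γ : SL(2, ℝ)) (z : ℍ) :
    ((γ • z).im : ℂ) ^ 2 = (z.im : ℂ) ^ 2 * (moebiusDeriv γ z * conj (moebiusDeriv γ z)) := by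
  have h : (γ • z).im = z.im / Complex.normSq (denom (γ : GL (Fin 2) ℝ) z) := by
    have := im_smul_eq_div_normSq (γ : GL (Fin 2) ℝ) z
    rw [Matrix.SpecialLinearGroup.coeToGL_det, Units.val_one, abs_one, one_mul] at this
    exact this
  have hne : (((γ 1 0 : ℝ) : ℂ) * z + ((γ 1 1 : ℝ) : ℂ)) ≠ 0 := by
    simpa [denom] using denom_ne_zero (γ : GL (Fin 2) ℝ) z
  have hne' : conj (((γ 1 0 : ℝ) : ℂ) * z + ((γ 1 1 : ℝ) : ℂ)) ≠ 0 :=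
    (map_ne_zero _).2 hne
  have hden : denom (γ : GL (Fin 2) ℝ) z = ((γ 1 0 : ℝ) : ℂ) * z + ((γ 1 1 : ℝ) : ℂ) := by
    simp [denom]
  rw [h, hden, moebiusDeriv_eq]
  push_cast
  rw [← Complex.mul_conj, map_div₀, map_pow, map_one]
  field_simp

theorem coeffPhi_smul (n : ℕ) {Γ : Subgroup SL(2, ℝ)} {f : ℍ → ℂ}
    (hf : IsHolomorphicDifferential Γ (n + 1) f) {γ : SL(2, ℝ)} (hγ : γ ∈ Γ) (z : ℍ) :
    conj (moebiusDeriv γ z) * coeffPhi n f (γ • z) = moebiusDeriv γ z ^ n * coeffPhi n f z := by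
  simp only [coeffPhi, pow_mul, im_smul_eq_mul_moebiusDeriv, ← hf.2 γ hγ z, map_mul, map_pow]
  ring

theorem isOneForm_Phi (n : ℕ) {Γ : Subgroup SL(2, ℝ)} {f : ℍ → ℂ}
    (hf : IsHolomorphicDifferential Γ (n + 1) f) : IsOneForm Γ (Phi n f) := by
  refine ⟨isSmooth_Phi n (isSmooth_of_holomorphic hf.1), fun γ hγ z X => ?_⟩
  rw [Phi_apply, Phi_apply, act]
  refine Prod.ext rfl (funext fun j => ?_)
  by_cases h : (j : ℕ) + 1 = n
  · simp only [h, if_true, map_mul]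
    linear_combination conj X * coeffPhi_smul n hf hγ z
  · simp [h]

/-- The connection of `L_n` annihilates the `(1, 0)`-part of the derivative of `y^{2n} \bar f`. -/
theorem derivAt_coeffPhi (n : ℕ) {f : ℍ → ℂ}
    (hf : DifferentiableOn ℂ (fun w : ℂ => f (ofComplex w)) {w | 0 < w.im}) (z : ℍ) :
    ∃ a : ℂ, ∀ X : ℂ, leviCivita n X (coeffPhi n f) z = a * conj X := by
  have hz : (z.im : ℂ) ≠ 0 := by exact_mod_cast z.im_ne_zero
  obtain ⟨d, hd⟩ : ∃ d : ℂ, HasDerivAt (fun w : ℂ => f (ofComplex w)) d z :=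
    ⟨_, (hf.differentiableAt (isOpen_im_pos.mem_nhds z.im_pos)).hasDerivAt⟩
  have h1 : HasFDerivAt (fun w : ℂ => conj (f (ofComplex w))) _ (z : ℂ) :=
    Complex.conjCLE.toContinuousLinearMap.hasFDerivAt.comp (z : ℂ)
      (hd.hasFDerivAt.restrictScalars ℝ)
  have h2 := ((Complex.ofRealCLM ∘L Complex.imCLM).hasFDerivAt (x := (z : ℂ))).pow (2 * n)
  have hev : (fun w : ℂ => coeffPhi n f (ofComplex w)) =ᶠ[𝓝 (z : ℂ)]
      fun w : ℂ => ((Complex.ofRealCLM ∘L Complex.imCLM) w) ^ (2 * n) *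
        conj (f (ofComplex w)) := by
    filter_upwards [isOpen_im_pos.mem_nhds z.im_pos] with w hw
    simp [coeffPhi, im_ofComplex_of_im_pos hw]
  have h3 := (hev.fderiv_eq (𝕜 := ℝ)).trans (h2.mul h1).fderiv
  rcases Nat.eq_zero_or_pos n with rfl | hn
  · refine ⟨conj d, fun X => ?_⟩
    rw [leviCivita, derivAt, h3]
    simp [mul_comm]
  obtain ⟨m, rfl⟩ : ∃ m, n = m + 1 := ⟨n - 1, by omega⟩
  have e : 2 * (m + 1) - 1 = 2 * m + 1 := by omega
  -- The coefficient of `\bar X`: the first term differentiates `\bar f`, the second is the `\bar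
  -- X`-half of the derivative of `y^{2n}`. The `X`-half cancels the connection form `n (i / y) X`.
  refine ⟨(z.im : ℂ) ^ (2 * (m + 1)) * conj d +
    (m + 1) * Complex.I * (z.im : ℂ) ^ (2 * m + 1) * conj (f z), fun X => ?_⟩
  have hX : (X.im : ℂ) = (conj X - X) * Complex.I / 2 := by
    apply Complex.ext <;> simp
  rw [leviCivita, derivAt, h3]
  simp [e, coeffPhi, hX]
  field_simp
  ring

theorem derivAt_conj_mul {Y c : ℍ → ℂ} (hY : IsSmooth Y) (hc : IsSmooth c) (z : ℍ) (X : ℂ) :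
    derivAt (fun w => conj (Y w) * c w) z X =
      conj (derivAt Y z X) * c z + conj (Y z) * derivAt c z X := by
  have h1 : HasFDerivAt (fun w : ℂ => conj (Y (ofComplex w))) _ (z : ℂ) :=
    Complex.conjCLE.toContinuousLinearMap.hasFDerivAt.comp (z : ℂ) (hY.hasFDerivAt z)
  have h2 : fderiv ℝ (fun w : ℂ => conj (Y (ofComplex w)) * c (ofComplex w)) z = _ :=
    (h1.mul (hc.hasFDerivAt z)).fderiv
  rw [derivAt, h2]
  simp
  ring

theorem comp_Phi {n : ℕ} (hn : 1 ≤ n) (f : ℍ → ℂ) (z : ℍ) (X : ℂ) (k : ℕ) :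
    comp (Phi n f z X) k = if k = n then conj X * coeffPhi n f z else 0 := by
  rw [Phi_apply]
  rcases k with _ | k
  · have : 0 ≠ n := by omega
    simp [comp, this]
  · by_cases h : k < n
    · simp [comp, h]
    · have : k + 1 ≠ n := by omega
      simp [comp, h, this]

theorem isDNablaClosed_Phi {n : ℕ} (hn : 1 ≤ n) {f : ℍ → ℂ}
    (hf : DifferentiableOn ℂ (fun w : ℂ => f (ofComplex w)) {w | 0 < w.im}) :
    IsDNablaClosed (Phi n f) := by
  intro X Y hX hY z
  have hc := isSmooth_coeffPhi n (isSmooth_of_holomorphic hf)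
  obtain ⟨a, ha⟩ := derivAt_coeffPhi n hf z
  refine Prod.ext ?_ (funext fun j => ?_)
  · simp only [dNabla, nabla, Prod.fst_sub, comp_Phi hn, metric, Phi_fst, derivAt_const]
    -- Degree 0 sees the form only when `n = 1`; there `⟨X, i_Y ω̌⟩` is symmetric in `X` and `Y`.
    by_cases h : 1 = n
    · simp only [h, if_true]
      simp
      ring
    · simp [h]
  · simp only [dNabla, nabla, Prod.snd_sub, Pi.sub_apply, comp_Phi hn, Phi_snd]
    change _ = (0 : ℂ)
    have hj := j.2
    -- The term `X ⊗ Y_n` would land in `L_{n+1}`, outside `E`.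
    have hjn : (j : ℕ) + 1 - 1 ≠ n := by omega
    by_cases h : (j : ℕ) + 1 = n
    · have h' : (j : ℕ) + 1 + 1 ≠ n := by omega
      simp only [h, if_true, VectorField.lieBracket, contract]
      have hX1 := ha (X z)
      have hY1 := ha (Y z)
      simp only [leviCivita] at hX1 hY1 ⊢
      rw [derivAt_conj_mul hX hc, derivAt_conj_mul hY hc]
      have e1 : n - 1 ≠ n := by omega
      have e2 : n + 1 ≠ n := by omega
      simp only [e1, e2, if_false, ofComplex_apply, map_sub]
      have d1 : fderiv ℝ (fun w : ℂ => Y (ofComplex w)) z = derivAt Y z := rfl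
      have d2 : fderiv ℝ (fun w : ℂ => X (ofComplex w)) z = derivAt X z := rfl
      rw [d1, d2]
      -- Derivatives of `X` and `Y` cancel against the Lie bracket, and the remaining `a \bar X \bar
      -- Y` is symmetric.
      linear_combination conj (Y z) * hX1 - conj (X z) * hY1
    · have d0 : ∀ V : ℂ, leviCivita ((j : ℕ) + 1) V (fun _ : ℍ => (0 : ℂ)) z = 0 := fun V => by
        simp [leviCivita, derivAt_const]
      simp only [h, hjn, if_false, d0, contract]
      by_cases h2 : (j : ℕ) + 1 + 1 = n
      · simp only [h2, if_true]
        simp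
        ring
      · simp [h2]

/-! ### A maximum principle -/

/-- Were `q' > 0`, the second derivative test would make `t` a local minimum too; then `h` is
locally constant and `q' = 0`. -/
theorem deriv_nonpos_of_isLocalMax {h q : ℝ → ℝ} {t q' : ℝ} (hmax : IsLocalMax h t)
    (hh : ∀ᶠ s in 𝓝 t, HasDerivAt h (q s) s) (hq : HasDerivAt q q' t) : q' ≤ 0 := by
  by_contra! hpos
  have hev : deriv h =ᶠ[𝓝 t] q := hh.mono fun s hs => hs.deriv
  have h2 : deriv (deriv h) t = q' := hev.deriv_eq.trans hq.deriv
  have hmin := isLocalMin_of_deriv_deriv_pos (h2 ▸ hpos) hmax.deriv_eq_zero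
    hh.self_of_nhds.continuousAt
  have hconst : h =ᶠ[𝓝 t] fun _ => h t := by
    filter_upwards [hmax, hmin] with s h1 h2 using le_antisymm h1 h2
  have h3 : deriv h =ᶠ[𝓝 t] fun _ => 0 := by
    simpa using hconst.deriv
  have h4 : deriv (deriv h) t = 0 := by simpa using h3.deriv_eq
  linarith

/-- Restriction to the line `s ↦ z + s X` reduces this to one variable. -/
theorem fderiv_nonpos_of_isLocalMax {E : Type*} [NormedAddCommGroup E] [NormedSpace ℝ E]
    {G q : E → ℝ} {G' : E → E →L[ℝ] ℝ} {q' : E →L[ℝ] ℝ} {z X : E} (hmax : IsLocalMax G z)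
    (hG : ∀ᶠ w in 𝓝 z, HasFDerivAt G (G' w) w ∧ G' w X = q w) (hq : HasFDerivAt q q' z) :
    q' X ≤ 0 := by
  have hline : ∀ s : ℝ, HasDerivAt (fun s : ℝ => z + s • X) X s := fun s => by
    simpa using ((hasDerivAt_id s).smul_const X).const_add z
  have hz : z + (0 : ℝ) • X = z := by simp
  have hcont : Tendsto (fun s : ℝ => z + s • X) (𝓝 0) (𝓝 z) := by
    simpa [ContinuousAt] using (hline 0).continuousAt
  refine deriv_nonpos_of_isLocalMax (h := fun s => G (z + s • X)) (q := fun s => q (z + s • X))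
    (t := 0) ?_ ?_ ?_
  · simpa [IsLocalMax, IsMaxFilter] using hcont.eventually hmax
  · filter_upwards [hcont.eventually hG] with s hs
    rw [← hs.2]
    exact hs.1.comp_hasDerivAt s (hline s)
  · exact HasFDerivAt.comp_hasDerivAt (0 : ℝ) (by simpa using hq) (hline 0)

/-- The function descends to the compact quotient and attains its maximum there. -/
theorem exists_forall_le_of_invariant {Γ : Subgroup SL(2, ℝ)}
    (hΓ : CompactSpace (MulAction.orbitRel.Quotient Γ ℍ)) {g : ℍ → ℝ} (hg : Continuous g)
    (hinv : ∀ γ ∈ Γ, ∀ z : ℍ, g (γ • z) = g z) : ∃ z, ∀ w, g w ≤ g z := by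
  have hrel : ∀ a b : ℍ, (MulAction.orbitRel Γ ℍ) a b → g a = g b := by
    rintro a b ⟨γ, rfl⟩
    exact hinv γ γ.2 b
  let q : MulAction.orbitRel.Quotient Γ ℍ → ℝ := Quotient.lift g hrel
  have hq : Continuous q := hg.quotient_lift hrel
  have : Nonempty (MulAction.orbitRel.Quotient Γ ℍ) := ⟨Quotient.mk _ UpperHalfPlane.I⟩
  obtain ⟨x, -, hx⟩ := isCompact_univ.exists_isMaxOn Set.univ_nonempty hq.continuousOn
  obtain ⟨z, rfl⟩ := Quotient.exists_rep x
  exact ⟨z, fun w => hx (Set.mem_univ (Quotient.mk _ w))⟩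

/-- If `∂̄ g = -(a/2) y⁻² p` and `∂ p + (i / y) p = -b g` with `a, b > 0`, so that
`y² Δ g = 2 a b g`, then `g` cannot have a positive maximum. -/
theorem nonpos_at_max {g : ℍ → ℝ} {p : ℍ → ℂ} {a b : ℝ} (ha : 0 < a) (hb : 0 < b)
    (hg : IsSmooth g) (hp : IsSmooth p)
    (h1 : ∀ z X, derivAt g z X = -(a * metric 1 z X (p z)))
    (h2 : ∀ z, leviCivita 1 1 p z - Complex.I * leviCivita 1 Complex.I p z
      = -((2 * b * g z : ℝ) : ℂ))
    {z : ℍ} (hz : ∀ w, g w ≤ g z) : g z ≤ 0 := by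
  have hy := z.im_pos
  set P : ℂ → ℂ := fun w => p (ofComplex w) with hP
  have hmax : IsLocalMax (fun w : ℂ => g (ofComplex w)) z :=
    Eventually.of_forall fun w => by simpa using hz (ofComplex w)
  have hG : ∀ X : ℂ, ∀ᶠ w : ℂ in 𝓝 (z : ℂ),
      HasFDerivAt (fun w : ℂ => g (ofComplex w)) (derivAt g (ofComplex w)) w ∧
        derivAt g (ofComplex w) X = (X * conj (P w)).re * (-a * (w.im ^ 2)⁻¹) := by
    intro X
    filter_upwards [isOpen_im_pos.mem_nhds z.im_pos] with w hw
    refine ⟨?_, ?_⟩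
    · have := hg.hasFDerivAt (ofComplex w)
      rwa [coe_ofComplex_of_im_pos hw] at this
    · rw [h1, metric, im_ofComplex_of_im_pos hw]
      simp only [hP, mul_one]
      ring
  have hq : ∀ X : ℂ, HasFDerivAt
      (fun w : ℂ => (X * conj (P w)).re * (-a * (w.im ^ 2)⁻¹)) _ (z : ℂ) := fun X =>
    (Complex.reCLM.hasFDerivAt.comp (z : ℂ)
      ((Complex.conjCLE.toContinuousLinearMap.hasFDerivAt.comp (z : ℂ)
        (hp.hasFDerivAt z)).const_mul X)).mul
    (((hasDerivAt_inv (x := (z : ℂ).im ^ 2) (pow_ne_zero _ hy.ne')).hasFDerivAt.comp (z : ℂ)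
      ((Complex.imCLM.hasFDerivAt (x := (z : ℂ))).pow 2)).const_mul (-a))
  -- The second derivatives of `g` along `1` and `i` are both nonpositive; their sum is `Δg`.
  have k1 := fderiv_nonpos_of_isLocalMax hmax (hG 1) (hq 1)
  have k2 := fderiv_nonpos_of_isLocalMax hmax (hG Complex.I) (hq Complex.I)
  -- The real part of `h2` is the equation `y² Δg = 2 a b g`, up to the factor `a`.
  have k3 := congrArg Complex.re (h2 z)
  simp [leviCivita] at k1 k2 k3
  field_simp at k1 k2 k3
  have k4 : 0 ≤ (derivAt p z 1).re := by
    rw [zero_mul] at k1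
    exact nonneg_of_mul_nonneg_right k1 ha
  by_contra! hpos
  have k5 : 0 ≤ z.im * (derivAt p z 1).re := by positivity
  have k6 : 0 < z.im * 2 * b * g z := by positivity
  linarith

/-! ### Vanishing of `ω` when `Φ(ω)` is exact -/

theorem act_fst {n : ℕ} (γ : SL(2, ℝ)) (z : ℍ) (Y : Fiber n) : (act γ z Y).1 = Y.1 := rfl

theorem nabla_fst {n : ℕ} (Y : ℍ → Fiber n) (z : ℍ) (X : ℂ) :
    (nabla Y z X).1 =
      derivAt (fun w => (Y w).1) z X + ((n : ℝ) + 1) / 2 * metric 1 z X (comp (Y z) 1) := rfl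

theorem nabla_snd {n : ℕ} (Y : ℍ → Fiber n) (z : ℍ) (X : ℂ) {k : ℕ} (hk : k < n) :
    (nabla Y z X).2 ⟨k, hk⟩ = ((n : ℂ) - k) * (X * comp (Y z) k)
      + leviCivita (k + 1) X (fun w => comp (Y w) (k + 1)) z
      + ((n : ℂ) + k + 2) / 4 * contract z X (comp (Y z) (k + 2)) := by
  simp only [nabla, Nat.add_sub_cancel]
  push_cast
  ring

/-- The component of degree `0` of a solution of `d^∇ u = Φ(ω)` vanishes. -/
theorem fst_eq_zero_of_nabla_eq_Phi {n : ℕ} (hn : 1 ≤ n) {Γ : Subgroup SL(2, ℝ)}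
    (hΓ : CompactSpace (MulAction.orbitRel.Quotient Γ ℍ)) {f : ℍ → ℂ} {u : ℍ → Fiber n}
    (hu : IsSection Γ u) (h : ∀ z X, Phi n f z X = nabla u z X) (z : ℍ) : (u z).1 = 0 := by
  have hn' : (0 : ℝ) < n := by exact_mod_cast hn
  have hg : IsSmooth fun z => (u z).1 := hu.1.clm_comp (ContinuousLinearMap.fst ℝ ℝ (Fin n → ℂ))
  have hp := isSmooth_comp hu.1 1
  have hinv : ∀ γ ∈ Γ, ∀ z : ℍ, (u (γ • z)).1 = (u z).1 := fun γ hγ z => by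
    rw [hu.2 γ hγ z, act_fst]
  have h1 : ∀ z X, derivAt (fun w => (u w).1) z X =
      -(((n : ℝ) + 1) / 2 * metric 1 z X (comp (u z) 1)) := fun z X => by
    have e := congrArg Prod.fst (h z X)
    rw [Phi_fst, nabla_fst] at e
    linarith
  have h2 : ∀ z, leviCivita 1 1 (fun w => comp (u w) 1) z
      - Complex.I * leviCivita 1 Complex.I (fun w => comp (u w) 1) z
      = -((2 * n * (u z).1 : ℝ) : ℂ) := fun z => by
    have e : ∀ X, _ := fun X => congrFun (congrArg Prod.snd (h z X)) ⟨0, hn⟩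
    simp only [nabla_snd, Phi_snd, contract] at e
    -- `Φ(ω)` enters degree 1 only when `n = 1`; in every case its contribution is antilinear in
    -- `X`.
    obtain ⟨c, hc⟩ : ∃ c : ℂ, ∀ X : ℂ,
        (if (0 : ℕ) + 1 = n then conj X * coeffPhi n f z else 0) = conj X * c := by
      by_cases h0 : (0 : ℕ) + 1 = n
      · exact ⟨coeffPhi n f z, fun X => by simp [h0]⟩
      · exact ⟨0, fun X => by simp [h0]⟩
    simp only [hc] at e
    have e1 := e 1
    have e2 := e Complex.I
    have hcomp : comp (u z) 0 = ((u z).1 : ℂ) := rfl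
    simp only [hcomp, Complex.conj_I, map_one, Nat.cast_zero, zero_add] at e1 e2
    push_cast
    -- For a real linear map `T`, `T(1) - i T(i)` is twice the coefficient of its complex linear
    -- part, so all multiples of `\bar X` drop out.
    linear_combination Complex.I * e2 - e1 +
      (n * (u z).1 + c - ((n : ℂ) + 2) / 4 * comp (u z) 2 / z.im ^ 2) * Complex.I_sq
  have hle : ∀ z, (u z).1 ≤ 0 := fun z => by
    obtain ⟨w, hw⟩ := exists_forall_le_of_invariant hΓ hg.continuous hinv
    exact (hw z).trans (nonpos_at_max (by positivity) hn' hg hp h1 h2 hw)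
  -- The system is linear, so the same bound applies to `(-u_0, -u_1)`.
  have hge : ∀ z, -(u z).1 ≤ 0 := fun z => by
    obtain ⟨w, hw⟩ := exists_forall_le_of_invariant (g := fun z => -(u z).1) hΓ
      hg.continuous.neg (fun γ hγ z => by rw [hinv γ hγ z])
    have hd : ∀ z, derivAt (fun w => -(u w).1) z = -derivAt (fun w => (u w).1) z := fun z =>
      (hg.hasFDerivAt z).neg.fderiv
    have hd' : ∀ z, derivAt (fun w => -comp (u w) 1) z = -derivAt (fun w => comp (u w) 1) z :=
      fun z => (hp.hasFDerivAt z).neg.fderiv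
    have hg' : IsSmooth fun z => -(u z).1 := ContDiffOn.neg hg
    have hp' : IsSmooth fun z => -comp (u z) 1 := ContDiffOn.neg hp
    refine (hw z).trans (nonpos_at_max (p := fun z => -comp (u z) 1)
      (by positivity : (0 : ℝ) < ((n : ℝ) + 1) / 2) hn' hg' hp' ?_ ?_ hw)
    · intro z X
      rw [hd, neg_apply, h1]
      simp only [metric, map_neg, mul_neg, Complex.neg_re]
      ring
    · intro z
      have e := h2 z
      simp only [leviCivita, hd', neg_apply] at e ⊢
      push_cast at e ⊢
      linear_combination -e
  exact le_antisymm (hle z) (by linarith [hge z])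

/-- A form `Φ(ω)` in the image of `d^∇` vanishes. -/
theorem eq_zero_of_isDNablaExact_Phi {n : ℕ} (hn : 1 ≤ n) {Γ : Subgroup SL(2, ℝ)}
    (hΓ : CompactSpace (MulAction.orbitRel.Quotient Γ ℍ)) {f : ℍ → ℂ}
    (hex : IsDNablaExact Γ (Phi n f)) : f = 0 := by
  obtain ⟨u, hu, h⟩ := hex
  have h0 := fst_eq_zero_of_nabla_eq_Phi hn hΓ hu h
  have hlc : ∀ k X z, leviCivita k X (fun _ => 0) z = 0 := fun k X z => by
    simp [leviCivita, derivAt_const]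
  have hy : ∀ z : ℍ, (z.im : ℂ) ≠ 0 := fun z => by exact_mod_cast z.im_ne_zero
  have h1 : ∀ z, comp (u z) 1 = 0 := fun z => by
    -- Taking `X = u_1(z)` turns the pairing into `|u_1|²`.
    have e := congrArg Prod.fst (h z (comp (u z) 1))
    rw [Phi_fst, nabla_fst] at e
    simp only [h0, derivAt_const, metric, Complex.mul_conj, Complex.ofReal_re] at e
    have hz := z.im_ne_zero
    have hn1 : (n : ℝ) + 1 ≠ 0 := by positivity
    simpa [hz, hn1] using e
  -- Two consecutive components are carried along: in the degree `k + 1` equation they leave only a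
  -- nonzero multiple of `i_X u_{k+2}`, `Φ(ω)` being absent below degree `n`.
  have hcomp : ∀ k, k + 1 ≤ n → ∀ z, comp (u z) k = 0 ∧ comp (u z) (k + 1) = 0 := by
    intro k
    induction k with
    | zero => exact fun _ z => ⟨by simp [comp, h0], h1 z⟩
    | succ k ih =>
      intro hk z
      have ih' := ih (by omega)
      have e := congrFun (congrArg Prod.snd (h z 1)) ⟨k, by omega⟩
      have hkn : k + 1 ≠ n := by omega
      have hc : (n : ℂ) + k + 2 ≠ 0 := by exact_mod_cast (by omega : n + k + 2 ≠ 0)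
      simp only [nabla_snd, Phi_snd, (ih' _).1, (ih' _).2, hlc, hkn, contract] at e
      exact ⟨(ih' z).2, by simpa [hc, hy z] using e⟩
  obtain ⟨m, rfl⟩ : ∃ m, n = m + 1 := ⟨n - 1, by omega⟩
  funext z
  have e := congrFun (congrArg Prod.snd (h z 1)) ⟨m, by omega⟩
  -- Here `m + 2 = n + 1`, where `comp` takes its default value 0.
  have hlast : comp (u z) (m + 2) = 0 := by simp [comp]
  have hcm := hcomp m le_rfl
  simp only [nabla_snd, Phi_snd, (hcm _).1, (hcm _).2, hlc, hlast, contract] at e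
  simpa [coeffPhi, hy z] using e

end Fuchsian

end

theorem mainTheorem4 (n : ℕ) (hn : 1 ≤ n) (Γ : Subgroup SL(2, ℝ))
    (hΓ : Fuchsian.IsSurfaceGroup Γ) (f : ℍ → ℂ)
    (hf : Fuchsian.IsHolomorphicDifferential Γ (n + 1) f) :
    Fuchsian.IsOneForm Γ (Fuchsian.Phi n f) ∧
      Fuchsian.IsDNablaClosed (Fuchsian.Phi n f) ∧
      (Fuchsian.IsDNablaExact Γ (Fuchsian.Phi n f) → f = 0) :=
  ⟨Fuchsian.isOneForm_Phi n hf, Fuchsian.isDNablaClosed_Phi hn hf.1,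
    Fuchsian.eq_zero_of_isDNablaExact_Phi hn hΓ.cocompact⟩
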